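/- Let $(M,\tau)$ be a von Neumann algebra with a normal faithful tracial state. A subset $X\subset M$ is called L-free if $$\tau(x_1x_2^*\cdots x_{2k-1}x_{2k}^*)=0\quad\text{and}\quad \tau(x_1^*x_2\cdots x_{2k-1}^*x_{2k})=0$$ whenever $k\ge 1$, $x_1,\dots,x_{2k}\in X$ and $x_i\ne x_{i+1}$ for all $i=1,\dots,2k-1$. Let $n\ge 2$ and let $u_1,\dots,u_n\in M$ be distinct unitaries such that $\{u_1,\dots,u_n\}$ is L-free. Then $$\Bigl\|\sum_{i=1}^n u_i\Bigr\| = 2\sqrt{n-1}.$$ Moreover, if $\alpha_1,\dots,\alpha_n\in\mathbb C$ satisfy $\sum_{i=1}^n|\alpha_i|^2\le 1$, then $$\Bigl\|\sum_{i=1}^n \alpha_i u_i\Bigr\| \le 2\sqrt{1-1/n}.$$ -/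

import Mathlib

/-- A normal faithful tracial state on a von Neumann algebra `M`. The order on `M` is the usual order
of a C⋆-algebra, in which the elements `star x * x` are the nonnegative ones. -/
structure IsNormalFaithfulTracialState {M : Type*} [CStarAlgebra M] [PartialOrder M]
    [StarOrderedRing M] (τ : M →ₗ[ℂ] ℂ) : Prop where
  /-- positivity: `τ (star x * x)` is a nonnegative real number -/
  re_nonneg : ∀ x : M, 0 ≤ (τ (star x * x)).re
  im_eq_zero : ∀ x : M, (τ (star x * x)).im = 0
  map_one : τ 1 = 1
  tracial : ∀ x y : M, τ (x * y) = τ (y * x)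
  faithful : ∀ x : M, τ (star x * x) = 0 → x = 0
  /-- normality: `τ` preserves suprema of upward directed sets of positive elements -/
  normal : ∀ (D : Set M) (a : M), D.Nonempty → DirectedOn (· ≤ ·) D → (∀ x ∈ D, 0 ≤ x) →
    IsLUB D a → IsLUB ((fun x => (τ x).re) '' D) (τ a).re

/-- A set `X` is L-free with respect to `τ` if
`τ (x₀ x₁* x₂ x₃* ⋯ x₂ₖ₋₂ x₂ₖ₋₁*) = 0` and `τ (x₀* x₁ x₂* x₃ ⋯ x₂ₖ₋₂* x₂ₖ₋₁) = 0` for all `k ≥ 1`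
and all `x₀, …, x₂ₖ₋₁ ∈ X` in which consecutive elements are distinct. (Only the values `x i` with
`i < 2 * k` of the sequence `x` matter.) -/
def IsLFree {M : Type*} [CStarAlgebra M] (τ : M →ₗ[ℂ] ℂ) (X : Set M) : Prop :=
  ∀ (k : ℕ) (x : ℕ → M), 1 ≤ k → (∀ i < 2 * k, x i ∈ X) →
    (∀ i, i + 1 < 2 * k → x i ≠ x (i + 1)) →
    τ ((List.range k).map (fun j => x (2 * j) * star (x (2 * j + 1)))).prod = 0 ∧
    τ ((List.range k).map (fun j => star (x (2 * j)) * x (2 * j + 1))).prod = 0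

/-! Put `x = ∑ αᵢ uᵢ`. Since the `uᵢ` are unitary, multiplying an alternating word by `uᵢ` or its
adjoint moves along an edge of the `n`-regular tree of reduced words; L-freeness kills the trace at
every nonempty reduced word of even length. So `τ ((x x*)^k)` is a weighted count of closed walks of
length `2k` at the root, and by faithfulness these moments control `‖x‖²`.

Upper bound: a positive multiplicative function on words, superharmonic with constant `C`, bounds
the moments by `C^(2k)`. Optimising it gives an Akemann–Ostrand bound; a good parameter and
Cauchy–Schwarz finish.

Lower bound: with all `αᵢ = 1` and `q = n - 1`, there are at least `q^k` times the `k`-th Catalan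
number such walks, which is `(4q)^k` up to a polynomial factor. -/

/-- `y` or its adjoint, depending on a sign. -/
def adjIf {M : Type*} [Star M] (b : Bool) (y : M) : M := if b then y else star y

/-- The alternating word `u i₀ * star (u i₁) * u i₂ * ⋯` (for `b = true`) or
`star (u i₀) * u i₁ * star (u i₂) * ⋯` (for `b = false`). -/
def altWord {M ι : Type*} [Monoid M] [Star M] (u : ι → M) : Bool → List ι → M
  | _, [] => 1
  | b, i :: w => adjIf b (u i) * altWord u (!b) w

/-- The alternating product of `m` factors `x`, `star x`, the rightmost one being `adjIf b x`. -/
def altPow {M : Type*} [Monoid M] [Star M] (x : M) : ℕ → Bool → M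
  | 0, _ => 1
  | m + 1, b => altPow x m (!b) * adjIf b x

/-- The neighbour of the reduced word `w` along the edge `i` in the regular tree whose vertices are
the words without equal consecutive letters. -/
def treeStep {ι : Type*} [DecidableEq ι] (i : ι) : List ι → List ι
  | [] => [i]
  | j :: w => if i = j then w else i :: j :: w

/-- The number of nonnegative lattice paths with steps `±1` from `0` to `l` having `j` down steps. -/
def ballotNumber : ℕ → ℕ → ℝ
  | 0, _ => 1
  | j + 1, l => ((l + 2 * j + 2).choose (j + 1) : ℝ) - ((l + 2 * j + 2).choose j : ℝ)

/-! ### Ballot and Catalan numbers -/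

section Ballot

/-- Split paths by their last step, up from `l` or down from `l + 2`; in formulas, Pascal's rule. -/
theorem ballotNumber_succ_succ (j l : ℕ) :
    ballotNumber (j + 1) (l + 1) = ballotNumber (j + 1) l + ballotNumber j (l + 2) := by
  cases j with
  | zero => simp [ballotNumber]; ring
  | succ j =>
    simp only [ballotNumber]
    have h1 : (l + 1 + 2 * (j + 1) + 2).choose (j + 1 + 1)
        = (l + 2 * (j + 1) + 2).choose (j + 1) + (l + 2 * (j + 1) + 2).choose (j + 1 + 1) := by
      rw [show l + 1 + 2 * (j + 1) + 2 = (l + 2 * (j + 1) + 2) + 1 by ring, Nat.choose_succ_succ]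
    have h2 : (l + 1 + 2 * (j + 1) + 2).choose (j + 1)
        = (l + 2 * (j + 1) + 2).choose j + (l + 2 * (j + 1) + 2).choose (j + 1) := by
      rw [show l + 1 + 2 * (j + 1) + 2 = (l + 2 * (j + 1) + 2) + 1 by ring, Nat.choose_succ_succ]
    rw [h1, h2, show l + 2 + 2 * j + 2 = l + 2 * (j + 1) + 2 by ring]
    push_cast
    ring

theorem ballotNumber_succ_zero (j : ℕ) : ballotNumber (j + 1) 0 = ballotNumber j 1 := by
  cases j with
  | zero => norm_num [ballotNumber]
  | succ j =>
    simp only [ballotNumber]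
    have h1 : (0 + 2 * (j + 1) + 2).choose (j + 1 + 1)
        = (1 + 2 * j + 2).choose (j + 1) + (1 + 2 * j + 2).choose (j + 1 + 1) := by
      rw [show 0 + 2 * (j + 1) + 2 = (1 + 2 * j + 2) + 1 by ring, Nat.choose_succ_succ]
    have h2 : (0 + 2 * (j + 1) + 2).choose (j + 1)
        = (1 + 2 * j + 2).choose j + (1 + 2 * j + 2).choose (j + 1) := by
      rw [show 0 + 2 * (j + 1) + 2 = (1 + 2 * j + 2) + 1 by ring, Nat.choose_succ_succ]
    have h3 : (1 + 2 * j + 2).choose (j + 1 + 1) = (1 + 2 * j + 2).choose (j + 1) := by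
      apply Nat.choose_symm_of_eq_add; ring
    rw [h1, h2, h3]
    push_cast
    ring

theorem ballotNumber_nonneg (j l : ℕ) : 0 ≤ ballotNumber j l := by
  induction j generalizing l with
  | zero => simp [ballotNumber]
  | succ j ih =>
    induction l with
    | zero => rw [ballotNumber_succ_zero]; exact ih 1
    | succ l ihl => rw [ballotNumber_succ_succ]; exact add_nonneg ihl (ih _)

theorem ballotNumber_succ_zero_mul (j : ℕ) :
    ballotNumber (j + 1) 0 * (j + 2) = (Nat.centralBinom (j + 1) : ℝ) := by
  have h := Nat.choose_succ_right_eq (2 * (j + 1)) j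
  rw [show 2 * (j + 1) - j = j + 2 by omega] at h
  have h' : ((2 * (j + 1)).choose (j + 1) : ℝ) * (j + 1) = (2 * (j + 1)).choose j * (j + 2) := by
    exact_mod_cast h
  simp only [ballotNumber, Nat.centralBinom]
  rw [show 0 + 2 * j + 2 = 2 * (j + 1) by ring]
  linarith

theorem four_pow_le_mul_ballotNumber (j : ℕ) :
    (4 : ℝ) ^ (j + 1) ≤ 2 * (j + 1) * (j + 2) * ballotNumber (j + 1) 0 := by
  have h := Nat.four_pow_le_two_mul_self_mul_centralBinom (j + 1) (Nat.succ_pos j)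
  have h' : (4 : ℝ) ^ (j + 1) ≤ 2 * (j + 1) * (Nat.centralBinom (j + 1) : ℝ) := by
    exact_mod_cast h
  rw [← ballotNumber_succ_zero_mul] at h'
  linarith

end Ballot

/-! ### Alternating words and the tree -/

section Words

variable {M ι : Type*}

theorem altPow_two_mul [Monoid M] [Star M] (x : M) (k : ℕ) :
    altPow x (2 * k) false = (x * star x) ^ k := by
  induction k with
  | zero => simp [altPow]
  | succ k ih =>
    rw [show 2 * (k + 1) = 2 * k + 1 + 1 by ring, pow_succ, ← ih]
    simp [altPow, adjIf, mul_assoc]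

theorem isChain_treeStep [DecidableEq ι] (i : ι) {w : List ι} (hw : w.IsChain (· ≠ ·)) :
    (treeStep i w).IsChain (· ≠ ·) := by
  cases w with
  | nil => simp [treeStep]
  | cons j w =>
    by_cases h : i = j
    · simpa [treeStep, h] using hw.tail
    · simp only [treeStep, h, if_false]
      exact List.isChain_cons_cons.2 ⟨h, hw⟩

theorem even_length_treeStep [DecidableEq ι] (i : ι) (w : List ι) :
    Even (treeStep i w).length ↔ ¬ Even w.length := by
  cases w with
  | nil => simp [treeStep]
  | cons j w =>
    by_cases h : i = j <;> simp [treeStep, h, Nat.even_add_one]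

theorem adjIf_mul_altWord [CStarAlgebra M] [DecidableEq ι] {u : ι → M}
    (hu : ∀ i, u i ∈ unitary M) (b : Bool) (i : ι) (w : List ι) :
    adjIf b (u i) * altWord u (!b) w = altWord u b (treeStep i w) := by
  cases w with
  | nil => simp [treeStep, altWord]
  | cons j w =>
    by_cases h : i = j
    · subst h
      cases b
      · simp [treeStep, altWord, adjIf, ← mul_assoc, Unitary.star_mul_self_of_mem (hu i)]
      · simp [treeStep, altWord, adjIf, ← mul_assoc, Unitary.mul_star_self_of_mem (hu i)]
    · simp [treeStep, h, altWord]

theorem altPow_succ_mul_altWord [CStarAlgebra M] [DecidableEq ι] [Fintype ι] {u : ι → M}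
    (hu : ∀ i, u i ∈ unitary M) (α : ι → ℂ) (m : ℕ) (b : Bool) (w : List ι) :
    altPow (∑ i, α i • u i) (m + 1) b * altWord u (!b) w =
      ∑ i, adjIf b (α i) • (altPow (∑ i, α i • u i) m (!b) * altWord u b (treeStep i w)) := by
  have h : adjIf b (∑ i, α i • u i) = ∑ i, adjIf b (α i) • adjIf b (u i) := by
    cases b <;> simp [adjIf, star_sum]
  rw [altPow, h, mul_assoc, Finset.sum_mul, Finset.mul_sum]
  refine Finset.sum_congr rfl fun i _ => ?_
  rw [smul_mul_assoc, mul_smul_comm, adjIf_mul_altWord hu]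

theorem altWord_eq_prod [Monoid M] [Star M] (u : ι → M) (d : ι) (k : ℕ) (w : List ι)
    (hw : w.length = 2 * k) :
    altWord u true w = ((List.range k).map
      (fun j => u (w.getD (2 * j) d) * star (u (w.getD (2 * j + 1) d)))).prod ∧
    altWord u false w = ((List.range k).map
      (fun j => star (u (w.getD (2 * j) d)) * u (w.getD (2 * j + 1) d))).prod := by
  induction k generalizing w with
  | zero => simp_all [altWord]
  | succ k ih =>
    match w, hw with
    | i :: j :: w, hw =>
      have hw' : w.length = 2 * k := by simp at hw; omega
      obtain ⟨h1, h2⟩ := ih w hw'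
      constructor
      · simp [altWord, adjIf, h1, List.range_succ_eq_map, Function.comp_def, mul_assoc, mul_add]
      · simp [altWord, adjIf, h2, List.range_succ_eq_map, Function.comp_def, mul_assoc, mul_add]

theorem IsLFree.trace_altWord [CStarAlgebra M] {τ : M →ₗ[ℂ] ℂ} {u : ι → M}
    (hfree : IsLFree τ (Set.range u)) (hinj : Function.Injective u) (b : Bool) {w : List ι}
    (hw : w.IsChain (· ≠ ·)) (heven : Even w.length) (hne : w ≠ []) :
    τ (altWord u b w) = 0 := by
  obtain ⟨k, hk⟩ := heven
  rw [← two_mul] at hk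
  let d : ι := w.head hne
  have hk1 : 1 ≤ k := by
    have := List.length_pos_iff.2 hne
    omega
  obtain ⟨h1, h2⟩ := hfree k (fun i => u (w.getD i d)) hk1 (fun i _ => ⟨_, rfl⟩) (by
    intro i hi heq
    have := List.isChain_iff_getElem.1 hw i (by omega)
    apply this
    have h := hinj heq
    rwa [List.getD_eq_getElem _ _ (by omega), List.getD_eq_getElem _ _ (by omega)] at h)
  obtain ⟨e1, e2⟩ := altWord_eq_prod u d k w hk
  cases b
  · rw [e2]; exact h2
  · rw [e1]; exact h1

end Words

/-! ### Moments as walk counts -/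

section Moments

variable {M ι : Type*} [CStarAlgebra M] [DecidableEq ι] [Fintype ι]

/-- A positive function on the tree that is `C`-superharmonic for the weighted adjacency operator
bounds the moments. -/
theorem norm_trace_altPow_mul_altWord_le {τ : M →ₗ[ℂ] ℂ} (hone : τ 1 = 1) {u : ι → M}
    (hu : ∀ i, u i ∈ unitary M) (hinj : Function.Injective u) (hfree : IsLFree τ (Set.range u))
    (α : ι → ℂ) (t : ι → ℝ) (ht : ∀ i, 0 < t i) (C : ℝ) (hC : ∑ i, ‖α i‖ * t i ≤ C)
    (hCj : ∀ j, ‖α j‖ + t j * (∑ i, ‖α i‖ * t i - ‖α j‖ * t j) ≤ C * t j)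
    (m : ℕ) (b : Bool) (w : List ι) (hw : w.IsChain (· ≠ ·)) (heven : Even (m + w.length)) :
    ‖τ (altPow (∑ i, α i • u i) m (!b) * altWord u b w)‖ ≤ C ^ m * (w.map t).prod := by
  have hC0 : 0 ≤ C := (Finset.sum_nonneg fun i _ => by have := ht i; positivity).trans hC
  have hpos : ∀ v : List ι, 0 < (v.map t).prod := fun v =>
    List.prod_pos (by simpa using fun i _ => ht i)
  induction m generalizing b w with
  | zero =>
    rcases eq_or_ne w [] with rfl | hne
    · simp [altPow, altWord, hone]
    · simp only [altPow, one_mul, pow_zero]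
      rw [hfree.trace_altWord hinj b hw (by simpa using heven) hne, norm_zero]
      exact (hpos w).le
  | succ m ih =>
    have hstep : ∑ i, ‖α i‖ * ((treeStep i w).map t).prod ≤ C * (w.map t).prod := by
      cases w with
      | nil => simpa [treeStep] using hC
      | cons j w =>
        -- Every edge multiplies the weight by `t i`, except the one towards the root, which removes
        -- `t j`; the `if` corrects that term.
        have e : ∀ i, ‖α i‖ * ((treeStep i (j :: w)).map t).prod =
            (w.map t).prod * (t j * (‖α i‖ * t i) +
              if i = j then ‖α j‖ - t j * (‖α j‖ * t j) else 0) := by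
          intro i
          by_cases h : i = j
          · subst h; simp [treeStep]; ring
          · simp [treeStep, h]; ring
        rw [Finset.sum_congr rfl fun i _ => e i, ← Finset.mul_sum, Finset.sum_add_distrib,
          ← Finset.mul_sum, Finset.sum_ite_eq' Finset.univ j, if_pos (Finset.mem_univ j),
          List.map_cons, List.prod_cons]
        have := mul_le_mul_of_nonneg_left (hCj j) (hpos w).le
        linarith
    have e := altPow_succ_mul_altWord hu α m (!b) w
    rw [Bool.not_not] at e
    rw [e, map_sum]
    calc ‖∑ i, τ (adjIf (!b) (α i) • (altPow (∑ i, α i • u i) m b * altWord u (!b) (treeStep i w)))‖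
        ≤ ∑ i, ‖α i‖ * (C ^ m * ((treeStep i w).map t).prod) := by
          refine norm_sum_le_of_le _ fun i _ => ?_
          have hn : ‖adjIf (!b) (α i)‖ = ‖α i‖ := by cases b <;> simp [adjIf]
          rw [map_smul, norm_smul, hn]
          refine mul_le_mul_of_nonneg_left ?_ (norm_nonneg _)
          have := ih (!b) (treeStep i w) (isChain_treeStep i hw) (by
            rw [Nat.even_add, even_length_treeStep]
            rw [Nat.even_add, Nat.even_add_one] at heven
            tauto)
          rwa [Bool.not_not] at this
      _ = C ^ m * ∑ i, ‖α i‖ * ((treeStep i w).map t).prod := by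
          rw [Finset.mul_sum]; exact Finset.sum_congr rfl fun i _ => by ring
      _ ≤ C ^ m * (C * (w.map t).prod) := mul_le_mul_of_nonneg_left hstep (by positivity)
      _ = C ^ (m + 1) * (w.map t).prod := by ring

theorem trace_altPow_succ_mul_altWord {τ : M →ₗ[ℂ] ℂ} {u : ι → M}
    (hu : ∀ i, u i ∈ unitary M) (m : ℕ) (b : Bool) (w : List ι) :
    (τ (altPow (∑ i, u i) (m + 1) (!b) * altWord u b w)).re =
      ∑ i, (τ (altPow (∑ i, u i) m b * altWord u (!b) (treeStep i w))).re := by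
  have e := altPow_succ_mul_altWord hu (fun _ => 1) m (!b) w
  have h1 : adjIf (!b) (1 : ℂ) = 1 := by cases b <;> simp [adjIf]
  simp only [Bool.not_not, one_smul, h1] at e
  rw [e, map_sum, Complex.re_sum]

theorem trace_altPow_mul_altWord_nonneg {τ : M →ₗ[ℂ] ℂ} (hone : τ 1 = 1) {u : ι → M}
    (hu : ∀ i, u i ∈ unitary M) (hinj : Function.Injective u) (hfree : IsLFree τ (Set.range u))
    (m : ℕ) (b : Bool) (w : List ι) (hw : w.IsChain (· ≠ ·)) (heven : Even (m + w.length)) :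
    0 ≤ (τ (altPow (∑ i, u i) m (!b) * altWord u b w)).re := by
  induction m generalizing b w with
  | zero =>
    rcases eq_or_ne w [] with rfl | hne
    · simp [altPow, altWord, hone]
    · simp only [altPow, one_mul]
      rw [hfree.trace_altWord hinj b hw (by simpa using heven) hne, Complex.zero_re]
  | succ m ih =>
    rw [trace_altPow_succ_mul_altWord hu]
    refine Finset.sum_nonneg fun i _ => ?_
    have := ih (!b) (treeStep i w) (isChain_treeStep i hw) (by
      rw [Nat.even_add, even_length_treeStep]
      rw [Nat.even_add, Nat.even_add_one] at heven
      tauto)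
    rwa [Bool.not_not] at this

/-- Off the root, one edge leads back and `q` lead away, matching the ballot recurrence with a
factor `q` for each pair of opposite steps. -/
theorem ballotNumber_le_trace_altPow_mul_altWord {τ : M →ₗ[ℂ] ℂ} (hone : τ 1 = 1) {u : ι → M}
    (hu : ∀ i, u i ∈ unitary M) (hinj : Function.Injective u) (hfree : IsLFree τ (Set.range u))
    (q : ℕ) (hq : Fintype.card ι = q + 1)
    (m : ℕ) (b : Bool) (w : List ι) (hw : w.IsChain (· ≠ ·)) (j : ℕ) (hm : m = w.length + 2 * j) :
    (q : ℝ) ^ j * ballotNumber j w.length ≤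
      (τ (altPow (∑ i, u i) m (!b) * altWord u b w)).re := by
  induction m generalizing b w j with
  | zero =>
    obtain rfl : j = 0 := by omega
    obtain rfl : w = [] := List.length_eq_zero_iff.1 (by omega)
    simp [altPow, altWord, hone, ballotNumber]
  | succ m ih =>
    rw [trace_altPow_succ_mul_altWord hu]
    have ih' := fun v hv j hm => ih (!b) v hv j hm
    simp only [Bool.not_not] at ih'
    cases w with
    | nil =>
      obtain ⟨j, rfl⟩ : ∃ j', j = j' + 1 := ⟨j - 1, by simp at hm; omega⟩
      have h1 : ∀ i : ι, (q : ℝ) ^ j * ballotNumber j 1 ≤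
          (τ (altPow (∑ i, u i) m b * altWord u (!b) (treeStep i []))).re := fun i =>
        ih' (treeStep i []) (isChain_treeStep i hw) j (by simp [treeStep] at hm ⊢; omega)
      have h2 := Finset.card_nsmul_le_sum Finset.univ _ _ fun i _ => h1 i
      rw [Finset.card_univ, hq, nsmul_eq_mul] at h2
      refine le_trans ?_ h2
      -- The root has `q + 1` outgoing edges; counting only `q` suffices.
      rw [List.length_nil, ballotNumber_succ_zero]
      have := ballotNumber_nonneg j 1
      have : 0 ≤ (q : ℝ) ^ j * ballotNumber j 1 := by positivity
      push_cast
      rw [pow_succ]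
      linarith
    | cons a w =>
      rw [← Finset.add_sum_erase _ _ (Finset.mem_univ a)]
      have h0 : (q : ℝ) ^ j * ballotNumber j w.length ≤
          (τ (altPow (∑ i, u i) m b * altWord u (!b) (treeStep a (a :: w)))).re := by
        have := ih' w hw.tail j (by simp at hm; omega)
        simpa [treeStep] using this
      cases j with
      | zero =>
        refine le_trans ?_ (add_le_add h0 (Finset.sum_nonneg fun i _ => ?_))
        · simp [ballotNumber]
        · have := trace_altPow_mul_altWord_nonneg hone hu hinj hfree m (!b) (treeStep i (a :: w))
            (isChain_treeStep i hw) (by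
              rw [Nat.even_add, even_length_treeStep]
              have : m = w.length := by simp at hm; omega
              simp [this, Nat.even_add_one])
          rwa [Bool.not_not] at this
      | succ j =>
        have h1 : ∀ i ∈ Finset.univ.erase a, (q : ℝ) ^ j * ballotNumber j (w.length + 2) ≤
            (τ (altPow (∑ i, u i) m b * altWord u (!b) (treeStep i (a :: w)))).re := by
          intro i hi
          have hia : i ≠ a := Finset.ne_of_mem_erase hi
          have := ih' (treeStep i (a :: w)) (isChain_treeStep i hw) j (by
            simp [treeStep, hia] at hm ⊢; omega)
          simpa [treeStep, hia] using this
        have h2 := Finset.card_nsmul_le_sum _ _ _ h1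
        rw [Finset.card_erase_of_mem (Finset.mem_univ a), Finset.card_univ, hq, nsmul_eq_mul,
          Nat.add_sub_cancel] at h2
        refine le_trans ?_ (add_le_add h0 h2)
        rw [List.length_cons, ballotNumber_succ_succ, pow_succ]
        linarith

end Moments

/-! ### Norm from moments -/

section Norm

variable {M : Type*} [CStarAlgebra M] [PartialOrder M] [StarOrderedRing M] {τ : M →ₗ[ℂ] ℂ}

theorem IsNormalFaithfulTracialState.re_apply_nonneg (hτ : IsNormalFaithfulTracialState τ)
    {a : M} (ha : 0 ≤ a) : 0 ≤ (τ a).re := by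
  obtain ⟨y, rfl⟩ := CStarAlgebra.nonneg_iff_eq_star_mul_self.1 ha
  exact hτ.re_nonneg y

theorem IsNormalFaithfulTracialState.re_mono (hτ : IsNormalFaithfulTracialState τ)
    {a b : M} (hab : a ≤ b) : (τ a).re ≤ (τ b).re := by
  have := hτ.re_apply_nonneg (sub_nonneg.2 hab)
  rw [map_sub, Complex.sub_re] at this
  linarith

theorem IsNormalFaithfulTracialState.eq_zero_of_re_nonpos (hτ : IsNormalFaithfulTracialState τ)
    {a : M} (ha : 0 ≤ a) (h : (τ a).re ≤ 0) : a = 0 := by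
  obtain ⟨y, rfl⟩ := CStarAlgebra.nonneg_iff_eq_star_mul_self.1 ha
  have := hτ.faithful y (Complex.ext (le_antisymm h (hτ.re_nonneg y)) (hτ.im_eq_zero y))
  simp [this]

theorem IsNormalFaithfulTracialState.re_apply_le_norm (hτ : IsNormalFaithfulTracialState τ)
    {a : M} (ha : IsSelfAdjoint a) : (τ a).re ≤ ‖a‖ := by
  have h := hτ.re_mono ha.le_algebraMap_norm_self
  rw [Algebra.algebraMap_eq_smul_one, ← Complex.coe_smul, map_smul, hτ.map_one] at h
  simpa using h

/-- A Markov inequality: for `r > c`, the part `(a - r)₊` has trace at most `‖a‖ (c / r)^k` for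
every `k`, so it vanishes by faithfulness. -/
theorem IsNormalFaithfulTracialState.norm_le_of_moments_le (hτ : IsNormalFaithfulTracialState τ)
    {a : M} (ha : 0 ≤ a) {c : ℝ} (hc : 0 ≤ c) (h : ∀ k : ℕ, (τ (a ^ k)).re ≤ c ^ k) :
    ‖a‖ ≤ c := by
  refine le_of_forall_gt_imp_ge_of_dense fun r hr => ?_
  have hr0 : 0 < r := hc.trans_lt hr
  have hsa : IsSelfAdjoint a := ha.isSelfAdjoint
  let f : ℝ → ℝ := fun s => max (s - r) 0
  have hf : Continuous f := by fun_prop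
  have hb : 0 ≤ cfc f a := cfc_nonneg fun s _ => le_max_right _ _
  have hk : ∀ k : ℕ, (τ (cfc f a)).re ≤ ‖a‖ * (c / r) ^ k := by
    intro k
    have hle : cfc (fun s => r ^ k * f s) a ≤ cfc (fun s => ‖a‖ * s ^ k) a := by
      refine cfc_mono (fun s hs => ?_) (by fun_prop) (by fun_prop)
      have hs0 : 0 ≤ s := spectrum_nonneg_of_nonneg ha hs
      have hs1 : s ≤ ‖a‖ := (le_abs_self s).trans (by
        rcases subsingleton_or_nontrivial M with _ | _
        · exact absurd hs (by simp [spectrum.of_subsingleton])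
        · exact spectrum.norm_le_norm_of_mem hs)
      rcases le_total s r with hsr | hsr
      · have : f s = 0 := max_eq_right (by linarith)
        rw [this, mul_zero]; positivity
      · have : f s ≤ ‖a‖ := max_le (by linarith) (norm_nonneg _)
        calc r ^ k * f s ≤ s ^ k * ‖a‖ := by gcongr
          _ = _ := mul_comm _ _
    rw [cfc_const_mul _ _ _ hf.continuousOn, cfc_const_mul _ _ _ (by fun_prop),
      cfc_pow_id a k] at hle
    have := hτ.re_mono hle
    rw [← Complex.coe_smul, ← Complex.coe_smul, map_smul, map_smul, smul_eq_mul, smul_eq_mul,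
      Complex.re_ofReal_mul, Complex.re_ofReal_mul] at this
    have h2 := mul_le_mul_of_nonneg_left (h k) (norm_nonneg a)
    rw [div_pow, ← mul_div_assoc, le_div_iff₀ (by positivity)]
    linarith
  have hlim : Filter.Tendsto (fun k : ℕ => ‖a‖ * (c / r) ^ k) Filter.atTop (nhds (‖a‖ * 0)) :=
    (tendsto_pow_atTop_nhds_zero_of_lt_one (by positivity) ((div_lt_one hr0).2 hr)).const_mul _
  rw [mul_zero] at hlim
  have hz : cfc f a = 0 := hτ.eq_zero_of_re_nonpos hb (ge_of_tendsto' hlim hk)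
  have hle : cfc (fun s : ℝ => s) a ≤ cfc (fun s => f s + r) a :=
    cfc_mono (fun s _ => by have := le_max_left (s - r) 0; simp only [f]; linarith)
      (by fun_prop) (by fun_prop)
  rw [cfc_id' ℝ a, cfc_add_const r f a hf.continuousOn, hz, zero_add] at hle
  exact (CStarAlgebra.norm_le_iff_le_algebraMap a hr0.le ha).2 hle

end Norm

/-! ### Norm bounds for L-free unitaries -/

section LFree

variable {M ι : Type*} [CStarAlgebra M] [PartialOrder M] [StarOrderedRing M] [DecidableEq ι]
  [Fintype ι] {τ : M →ₗ[ℂ] ℂ}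

theorem norm_sum_smul_le_of_isLFree (hτ : IsNormalFaithfulTracialState τ) {u : ι → M}
    (hu : ∀ i, u i ∈ unitary M) (hinj : Function.Injective u) (hfree : IsLFree τ (Set.range u))
    (α : ι → ℂ) (t : ι → ℝ) (ht : ∀ i, 0 < t i) (C : ℝ) (hC : ∑ i, ‖α i‖ * t i ≤ C)
    (hCj : ∀ j, ‖α j‖ + t j * (∑ i, ‖α i‖ * t i - ‖α j‖ * t j) ≤ C * t j) :
    ‖∑ i, α i • u i‖ ≤ C := by
  have hC0 : 0 ≤ C := (Finset.sum_nonneg fun i _ => by have := ht i; positivity).trans hC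
  have h := hτ.norm_le_of_moments_le (mul_star_self_nonneg (∑ i, α i • u i)) (sq_nonneg C)
    (fun k => by
      have := norm_trace_altPow_mul_altWord_le hτ.map_one hu hinj hfree α t ht C hC hCj (2 * k)
        true [] List.isChain_nil (by simp)
      rw [Bool.not_true, altPow_two_mul] at this
      simp only [altWord, mul_one, List.map_nil, List.prod_nil, pow_mul] at this
      exact (Complex.re_le_norm _).trans this)
  rw [CStarRing.norm_self_mul_star, ← sq] at h
  exact (sq_le_sq₀ (norm_nonneg _) hC0).1 h

/-- The upper bound of the Akemann–Ostrand formula. -/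
theorem norm_sum_smul_le_akemannOstrand (hτ : IsNormalFaithfulTracialState τ) {u : ι → M}
    (hu : ∀ i, u i ∈ unitary M) (hinj : Function.Injective u) (hfree : IsLFree τ (Set.range u))
    (α : ι → ℂ) {s : ℝ} (hs : 0 ≤ s) :
    ‖∑ i, α i • u i‖ ≤ 2 * s + ∑ i, (Real.sqrt (s ^ 2 + ‖α i‖ ^ 2) - s) := by
  -- The positive root of `‖α i‖ t² + 2 s t = ‖α i‖`, which makes superharmonicity at `i` an
  -- equality; if `α i = 0`, any positive value works.
  let t : ι → ℝ := fun i => if ‖α i‖ = 0 then 1 else (Real.sqrt (s ^ 2 + ‖α i‖ ^ 2) - s) / ‖α i‖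
  have hat : ∀ i, ‖α i‖ * t i = Real.sqrt (s ^ 2 + ‖α i‖ ^ 2) - s := by
    intro i
    by_cases h : ‖α i‖ = 0
    · simp [t, h, Real.sqrt_sq hs]
    · simp only [t, h, if_false]
      field_simp
  have ht : ∀ i, 0 < t i := by
    intro i
    by_cases h : ‖α i‖ = 0
    · simp only [t, h, if_true, zero_lt_one]
    · simp only [t, h, if_false]
      have hpos : 0 < ‖α i‖ := lt_of_le_of_ne (norm_nonneg _) (Ne.symm h)
      refine div_pos (sub_pos.2 (Real.lt_sqrt_of_sq_lt ?_)) hpos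
      have := pow_pos hpos 2
      linarith
  refine norm_sum_smul_le_of_isLFree hτ hu hinj hfree α t ht _ ?_ fun j => ?_
  · rw [Finset.sum_congr rfl fun i _ => hat i]
    linarith
  · rw [Finset.sum_congr rfl fun i _ => hat i]
    suffices ‖α j‖ - t j * (‖α j‖ * t j) ≤ 2 * s * t j by linarith
    rcases (norm_nonneg (α j)).eq_or_lt with h | h
    · rw [← h]
      have := ht j
      simp only [zero_mul, mul_zero, sub_zero]
      positivity
    · refine le_of_mul_le_mul_left ?_ h
      have e := Real.sq_sqrt (show 0 ≤ s ^ 2 + ‖α j‖ ^ 2 by positivity)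
      have h2 : ‖α j‖ * (‖α j‖ - t j * (‖α j‖ * t j)) = ‖α j‖ ^ 2 - (‖α j‖ * t j) ^ 2 := by ring
      have h3 : ‖α j‖ * (2 * s * t j) = 2 * s * (‖α j‖ * t j) := by ring
      rw [h2, h3, hat j]
      nlinarith

theorem four_mul_le_norm_sum_sq (hτ : IsNormalFaithfulTracialState τ) {u : ι → M}
    (hu : ∀ i, u i ∈ unitary M) (hinj : Function.Injective u) (hfree : IsLFree τ (Set.range u))
    (q : ℕ) (hq : Fintype.card ι = q + 1) :
    4 * (q : ℝ) ≤ ‖∑ i, u i‖ ^ 2 := by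
  set x := ∑ i, u i with hx
  have hmom : ∀ k : ℕ, (q : ℝ) ^ k * ballotNumber k 0 ≤ (‖x‖ ^ 2) ^ k := by
    intro k
    have h1 := ballotNumber_le_trace_altPow_mul_altWord hτ.map_one hu hinj hfree q hq (2 * k) true
      [] List.isChain_nil k (by simp)
    rw [Bool.not_true, altPow_two_mul, ← hx] at h1
    simp only [altWord, mul_one, List.length_nil] at h1
    have hsa : IsSelfAdjoint (x * star x) := IsSelfAdjoint.mul_star_self x
    refine h1.trans ((hτ.re_apply_le_norm (hsa.pow k)).trans ?_)
    have : Nontrivial M := ⟨⟨1, 0, fun h => by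
      have := hτ.map_one
      rw [h, map_zero] at this
      exact zero_ne_one this⟩⟩
    refine (norm_pow_le _ k).trans_eq ?_
    rw [CStarRing.norm_self_mul_star, ← sq]
  by_contra! hlt
  set r : ℝ := ‖x‖ ^ 2 with hr
  have hr0 : 0 ≤ r := sq_nonneg _
  have hq0 : 0 < 4 * (q : ℝ) := hr0.trans_lt hlt
  -- The factor `(k + 1) (k + 2)` is split as `(k + 1)² + (k + 1)`; the right side tends to `0`
  -- because `r < 4 q`.
  have hbound : ∀ k : ℕ, 1 ≤ 2 * (((k + 1 : ℕ) : ℝ) ^ 2 * (r / (4 * q)) ^ (k + 1) +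
      ((k + 1 : ℕ) : ℝ) ^ 1 * (r / (4 * q)) ^ (k + 1)) := by
    intro k
    have h1 := hmom (k + 1)
    have h2 := four_pow_le_mul_ballotNumber k
    have hqk : (0 : ℝ) ≤ (q : ℝ) ^ (k + 1) := by positivity
    have h3 : (4 * (q : ℝ)) ^ (k + 1) ≤ 2 * (k + 1) * (k + 2) * r ^ (k + 1) := by
      rw [mul_pow]
      calc (4 : ℝ) ^ (k + 1) * (q : ℝ) ^ (k + 1)
          ≤ (2 * (k + 1) * (k + 2) * ballotNumber (k + 1) 0) * (q : ℝ) ^ (k + 1) := by gcongr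
        _ = 2 * (k + 1) * (k + 2) * ((q : ℝ) ^ (k + 1) * ballotNumber (k + 1) 0) := by ring
        _ ≤ _ := by gcongr
    have h4 : 1 ≤ 2 * ((k : ℝ) + 1) * (k + 2) * (r / (4 * q)) ^ (k + 1) := by
      rw [div_pow, ← mul_div_assoc, le_div_iff₀ (by positivity), one_mul]
      exact h3
    push_cast
    linarith
  have hρ0 : 0 ≤ r / (4 * q) := by positivity
  have hρ1 : r / (4 * q) < 1 := (div_lt_one hq0).2 hlt
  have hlim := ((tendsto_pow_const_mul_const_pow_of_lt_one 2 hρ0 hρ1).add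
    (tendsto_pow_const_mul_const_pow_of_lt_one 1 hρ0 hρ1)).const_mul 2
  have := ge_of_tendsto' (hlim.comp (Filter.tendsto_add_atTop_nat 1)) hbound
  norm_num at this

end LFree

theorem corollary3p3 {M : Type*} [CStarAlgebra M] [WStarAlgebra M] [PartialOrder M]
    [StarOrderedRing M] (τ : M →ₗ[ℂ] ℂ) (hτ : IsNormalFaithfulTracialState τ)
    (n : ℕ) (hn : 2 ≤ n) (u : Fin n → M) (hinj : Function.Injective u)
    (hu : ∀ i, u i ∈ unitary M) (hfree : IsLFree τ (Set.range u)) :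
    ‖∑ i, u i‖ = 2 * Real.sqrt ((n : ℝ) - 1) ∧
    ∀ α : Fin n → ℂ, ∑ i, ‖α i‖ ^ 2 ≤ 1 →
      ‖∑ i, α i • u i‖ ≤ 2 * Real.sqrt (1 - 1 / (n : ℝ)) := by
  have hn' : (2 : ℝ) ≤ n := by exact_mod_cast hn
  have hn0 : (0 : ℝ) < n := by linarith
  have hq0 : 0 < (n : ℝ) - 1 := by linarith
  have hmain : ∀ α : Fin n → ℂ, ∑ i, ‖α i‖ ^ 2 ≤ 1 →
      ‖∑ i, α i • u i‖ ≤ 2 * Real.sqrt (1 - 1 / (n : ℝ)) := by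
    intro α hα
    set σ := Real.sqrt (((n : ℝ) - 1) * n) with hσ
    have hσ0 : 0 < σ := Real.sqrt_pos.2 (by positivity)
    have hσ2 : σ ^ 2 = ((n : ℝ) - 1) * n := Real.sq_sqrt (by positivity)
    -- The minimiser of the bound when all `‖α i‖` equal `1 / √n`.
    set s : ℝ := ((n : ℝ) - 2) / (2 * σ) with hs
    have hs0 : 0 ≤ s := div_nonneg (by linarith) (by positivity)
    have hsqrt : Real.sqrt (1 - 1 / (n : ℝ)) = σ / n := by
      rw [Real.sqrt_eq_iff_mul_self_eq_of_pos (by positivity)]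
      field_simp
      linarith
    refine (norm_sum_smul_le_akemannOstrand hτ hu hinj hfree α hs0).trans ?_
    rw [hsqrt, Finset.sum_sub_distrib, Finset.sum_const, Finset.card_univ, Fintype.card_fin,
      nsmul_eq_mul]
    -- Cauchy–Schwarz: the squared sum is at most `n (n s² + 1)`, a perfect square for this `s`.
    have hcs : ∑ i, Real.sqrt (s ^ 2 + ‖α i‖ ^ 2) ≤ (n : ℝ) ^ 2 / (2 * σ) := by
      refine abs_le_of_sq_le_sq' ?_ (by positivity) |>.2
      have h1 := sq_sum_le_card_mul_sum_sq (s := Finset.univ)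
        (f := fun i => Real.sqrt (s ^ 2 + ‖α i‖ ^ 2))
      have h2 : ∀ i, Real.sqrt (s ^ 2 + ‖α i‖ ^ 2) ^ 2 = s ^ 2 + ‖α i‖ ^ 2 := fun i =>
        Real.sq_sqrt (by positivity)
      simp only [h2, Finset.sum_add_distrib, Finset.sum_const, Finset.card_univ, Fintype.card_fin,
        nsmul_eq_mul] at h1
      have h3 : (n : ℝ) * (n * s ^ 2 + 1) = ((n : ℝ) ^ 2 / (2 * σ)) ^ 2 := by
        rw [hs, div_pow, div_pow, mul_pow, hσ2]
        field_simp
        ring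
      rw [← h3]
      refine h1.trans ?_
      gcongr
    have hval : (n : ℝ) ^ 2 / (2 * σ) = 2 * (σ / n) + (n - 2) * s := by
      rw [hs]
      field_simp
      rw [hσ2]
      ring
    linarith
  refine ⟨le_antisymm ?_ ?_, hmain⟩
  · have hsn : (0 : ℝ) < Real.sqrt n := Real.sqrt_pos.2 hn0
    have h := hmain (fun _ => (((Real.sqrt n)⁻¹ : ℝ) : ℂ)) (by
      simp only [Complex.norm_real, Finset.sum_const, Finset.card_univ, Fintype.card_fin,
        nsmul_eq_mul, Real.norm_eq_abs, sq_abs, inv_pow, Real.sq_sqrt hn0.le]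
      exact (mul_inv_cancel₀ hn0.ne').le)
    rw [← Finset.smul_sum, norm_smul, Complex.norm_real, Real.norm_of_nonneg (by positivity),
      inv_mul_le_iff₀ hsn] at h
    refine h.trans_eq ?_
    rw [mul_left_comm, ← Real.sqrt_mul hn0.le]
    congr 2
    field_simp
  · have h := four_mul_le_norm_sum_sq hτ hu hinj hfree (n - 1) (by
      rw [Fintype.card_fin]; omega)
    rw [Nat.cast_sub (by omega), Nat.cast_one] at h
    refine abs_le_of_sq_le_sq' ?_ (norm_nonneg _) |>.2
    rw [mul_pow, Real.sq_sqrt hq0.le]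
    linarith
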